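/- Model. A network is an $n$-vertex simple graph $G$ in which the vertices have distinct identifiers from $\{1,\dots,B(n)\}$, where $B:\mathbb N\to\mathbb N$ is a function with $B(n)\ge n$ for all $n$ (for instance a polynomial), and the edges at each vertex $v$ are numbered by ports $0,\dots,\deg(v)-1$ in an arbitrary way. A deterministic algorithm in the LOCAL model works as follows: each vertex starts in a state determined by $n$, its degree and its identifier; in each synchronous round it sends through each of its ports a message determined by its state and the port number, and then updates its state as a function of its old state and the messages received at its ports; message sizes and local computations are unrestricted. The first side in $\{0,1\}$ that a vertex announces, as a function of its state, is its irrevocable output. The algorithm finishes within $t$ rounds if every vertex has announced its output after at most $t$ rounds; the outputs of all vertices then form a cut, whose size is the number of edges with ends on different sides. The algorithm is an $\alpha$-approximation for MaxCut on a class of graphs if for every graph of the class, every admissible choice of identifiers and every port numbering, it finishes and outputs a cut of size at least $\alpha$ times the maximum size of a cut. It runs in $T(n)$ rounds on the class if it finishes within $T(n)$ rounds on every $n$-vertex graph of the class, for all admissible identifiers and all port numberings. Let $\log^* x=0$ for $x\le 1$ and $\log^* x=1+\log^*(\log_2 x)$ for $x>1$. Theorem. Let $d\ge 2$ be a fixed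 integer. 1. If $d$ is even, then any deterministic algorithm in the LOCAL model that guarantees a constant-factor approximation for MaxCut on the class of bipartite $d$-regular graphs needs $\Omega(\log^* n)$ rounds on $n$-vertex graphs. That is, for every real $\alpha>0$ there are $c>0$ and $n_0$, depending only on $d$ and $\alpha$, such that for all $B$ as above, every deterministic LOCAL algorithm that is an $\alpha$-approximation for MaxCut on bipartite $d$-regular graphs and runs in $T(n)$ rounds on this class satisfies $T(n)\ge c\log^* n$ for all even $n\ge n_0$. 2. If $d$ is odd, then for every real $\varepsilon>0$, any deterministic $\left(\frac1d+\varepsilon\right)$-approximation algorithm in the LOCAL model for MaxCut on the class of bipartite $d$-regular graphs needs $\Omega(\log^* n)$ rounds on $n$-vertex graphs. That is, for every real $\varepsilon>0$ there are $c>0$ and $n_0$, depending only on $d$ and $\varepsilon$, such that for all $B$ as above, every deterministic LOCAL algorithm that is a $\left(\frac1d+\varepsilon\right)$-approximation for MaxCut on bipartite $d$-regular graphs and runs in $T(n)$ rounds on this class satisfies $T(n)\ge c\log^* n$ for all even $n\ge n_0$. (A bipartite $d$-regular graph with $d\ge1$ has an even number of vertices, so for odd $n$ the class contains no graph.) -/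

import Mathlib

universe u

/-- For `x > 1`, passing from `x` to `log₂ x` decreases `⌈x⌉`. -/
theorem ceil_logb_two_lt {x : ℝ} (hx : ¬ x ≤ 1) : ⌈Real.logb 2 x⌉₊ < ⌈x⌉₊ := by
  have hx1 : 1 < x := not_le.mp hx
  rcases le_or_gt x 2 with h2 | h2
  · have h1 : Real.logb 2 x ≤ 1 := by
      rw [Real.logb_le_iff_le_rpow (by norm_num) (by linarith)]
      simpa using h2
    have h3 : ⌈Real.logb 2 x⌉₊ ≤ 1 := Nat.ceil_le.mpr (by simpa using h1)
    have h4 : 1 < ⌈x⌉₊ := Nat.lt_ceil.mpr (by simpa using hx1)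
    omega
  · have h1 : Real.logb 2 x ≤ x - 1 := by
      rw [Real.logb_le_iff_le_rpow (by norm_num) (by linarith)]
      have hb := one_add_mul_self_le_rpow_one_add (s := 1) (by norm_num)
        (p := x - 1) (by linarith)
      norm_num at hb
      exact hb
    have h3 : ⌈Real.logb 2 x⌉₊ ≤ ⌈x - 1⌉₊ := Nat.ceil_mono h1
    have h4 : ⌈x - 1⌉₊ = ⌈x⌉₊ - 1 := Nat.ceil_sub_one x
    have h5 : 1 < ⌈x⌉₊ := Nat.lt_ceil.mpr (by simpa using hx1)
    omega

/-- The iterated logarithm: `log* x = 0` if `x ≤ 1`, and `log* x = 1 + log* (log₂ x)` otherwise. -/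
noncomputable def logStar (x : ℝ) : ℕ :=
  if _h : x ≤ 1 then 0 else 1 + logStar (Real.logb 2 x)
termination_by ⌈x⌉₊
decreasing_by exact ceil_logb_two_lt _h

section Cut

variable {V : Type*}

/-- The size of the cut whose left side is `{v | x v = false}` and whose right side is
`{v | x v = true}`: the number of edges of `G` with one end on each side. -/
noncomputable def cutSize (G : SimpleGraph V) (x : V → Bool) : ℕ :=
  Set.ncard {e : Sym2 V | e ∈ G.edgeSet ∧ ∃ v w : V, e = s(v, w) ∧ x v = false ∧ x w = true}

/-- The maximum size of a cut of a finite graph. -/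
noncomputable def maxCut [Fintype V] [DecidableEq V] (G : SimpleGraph V) : ℕ :=
  Finset.univ.sup (cutSize G)

end Cut

/-- The data of a communication network on the graph `G` besides the graph itself: every vertex `v`
has an identifier, the identifiers are distinct integers between `1` and `B`, and the edges
at `v` are attached to ports of `v` numbered `0, …, deg v - 1` in an arbitrary way. -/
structure Labelling {n : ℕ} (G : SimpleGraph (Fin n)) [DecidableRel G.Adj] (B : ℕ) where
  ident : Fin n → ℕ
  ident_injective : Function.Injective ident
  one_le_ident : ∀ v, 1 ≤ ident v
  ident_le : ∀ v, ident v ≤ B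
  port : (v : Fin n) → Fin (G.degree v) ≃ G.neighborSet v

/-- A deterministic algorithm in the LOCAL model whose vertices output a side of a cut.
Local computations and message sizes are unrestricted.
* `init n k i` is the initial state of a vertex with degree `k` and identifier `i` in an
  `n`-vertex graph;
* `send s p` is the message that a vertex in state `s` sends through its port `p`;
* `recv s l` is the new state of a vertex that was in state `s` and received the messages `l`
  (listed by port number);
* `output s` is the side announced in state `s`, or `none` if the vertex is still undecided. -/
structure LocalAlgorithm where
  State : Type u
  Msg : Type u
  init : ℕ → ℕ → ℕ → State
  send : State → ℕ → Msg
  recv : State → List Msg → State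
  output : State → Option Bool

namespace LocalAlgorithm

variable (A : LocalAlgorithm.{u}) {n : ℕ} {G : SimpleGraph (Fin n)} [DecidableRel G.Adj] {B : ℕ}
  (L : Labelling G B)

/-- The state of each vertex after `t` synchronous rounds of communication. In a round, vertex `v`
receives through its port `i`, which leads to the neighbour `w`, the message that `w`
sends through the port of `w` that leads to `v`. -/
def state : ℕ → Fin n → A.State
  | 0, v => A.init n (G.degree v) (L.ident v)
  | t + 1, v =>
      A.recv (state t v) (List.ofFn fun i : Fin (G.degree v) =>
        let w := L.port v i
        A.send (state t w.1) ((L.port w.1).symm ⟨v, G.adj_symm w.2⟩).1)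

/-- The irrevocable decision of each vertex after `t` rounds: the first side that it has announced
during these rounds, or `none` if it is still undecided. -/
def decision : ℕ → Fin n → Option Bool
  | 0, v => A.output (A.state L 0 v)
  | t + 1, v => (decision t v).orElse fun _ => A.output (A.state L (t + 1) v)

/-- The execution of `A` is finished after at most `t` rounds. -/
def FinishedBy (t : ℕ) : Prop :=
  ∀ v, (A.decision L t v).isSome

/-- The execution of `A` comes to an end, and its output is the cut `x`. -/
def Computes (x : Fin n → Bool) : Prop :=
  ∃ t, ∀ v, A.decision L t v = some (x v)

/-- `A` is an `α`-approximation algorithm for MaxCut on the class of bipartite `d`-regular graphs,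
where the identifiers in `n`-vertex graphs range over `{1, …, B n}`. -/
def IsMaxCutApprox (d : ℕ) (B : ℕ → ℕ) (α : ℝ) : Prop :=
  ∀ (n : ℕ) (G : SimpleGraph (Fin n)) [DecidableRel G.Adj],
    G.IsBipartite → G.IsRegularOfDegree d → ∀ L : Labelling G (B n),
      ∃ x : Fin n → Bool, A.Computes L x ∧ α * (maxCut G : ℝ) ≤ (cutSize G x : ℝ)

/-- On every bipartite `d`-regular `n`-vertex graph, `A` finishes within `T n` rounds, where the
identifiers in `n`-vertex graphs range over `{1, …, B n}`. -/
def RunsIn (d : ℕ) (B : ℕ → ℕ) (T : ℕ → ℕ) : Prop :=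
  ∀ (n : ℕ) (G : SimpleGraph (Fin n)) [DecidableRel G.Adj],
    G.IsBipartite → G.IsRegularOfDegree d → ∀ L : Labelling G (B n), A.FinishedBy L (T n)

end LocalAlgorithm

/-!
The hard instances are bands: `m` columns in a cycle, with two vertices `(i, false)` and `(i, true)`
in column `i`, where `(i, b)` is joined to `(i + o, !b)` for the `d` offsets `o = ±1, ±3, …`,
together with `o = 0` if `d` is odd. A band is bipartite and `d`-regular with `2 m` vertices, so it
has a cut with all `m d` edges. It is a quotient of an infinite strip, in which the vertices
`(i, c)` form two strands: the edges with nonzero offset stay in a strand, and those with offset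
`0` cross. With the ports numbered by offset, the strip looks the same from all vertices of a
strand, apart from the identifiers. What a vertex announces within `t` rounds thus depends only on
its strand and on the identifiers in the `2 t d + 1` columns around it (`stripDecision_congr`,
`decision_bandLabelling`).

An algorithm therefore colours the windows of columns with the pair of sides that it announces in
the two strands of the middle column. A Ramsey argument for monotone paths (`exists_isMonoPath`)
gives an increasing sequence of `s` columns all whose windows have the same colour, in every set of
columns larger than a tower of exponentials of height `O(t d)` over `s ^ 4`. Since only
consecutive windows have to agree, it suffices to bound the chromatic number of shift graphs from
below, by repeated passage from a proper colouring to the sets of its colours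
(`card_le_of_shift_colouring`). If `log* n` is large compared to `t`, nearly all columns can be
arranged into such blocks (`exists_arrangement`). Away from the ends of the blocks, each strand
lies on one side, so nearly all cut edges have offset `0` (`exists_labelling_cutSize_le`): these
are at most a fraction `1 / d` of all edges if `d` is odd, and there are none if `d` is even.
-/

/-! ### Towers of exponentials and the iterated logarithm -/

/-- The tower `2 ^ 2 ^ ⋯ ^ 2 ^ q` with `j` twos below `q`. -/
def expTower (j q : ℕ) : ℕ := (fun x => 2 ^ x)^[j] q

theorem expTower_zero (q : ℕ) : expTower 0 q = q := rfl

theorem expTower_succ (j q : ℕ) : expTower (j + 1) q = expTower j (2 ^ q) := rfl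

theorem expTower_succ' (j q : ℕ) : expTower (j + 1) q = 2 ^ expTower j q :=
  Function.iterate_succ_apply' _ _ _

theorem le_expTower (j q : ℕ) : q ≤ expTower j q := by
  induction j with
  | zero => rfl
  | succ j ih =>
    rw [expTower_succ']
    exact ih.trans Nat.lt_two_pow_self.le

theorem mul_expTower_le (j : ℕ) {C q : ℕ} (hC : 1 ≤ C) (hq : 1 ≤ q) :
    C * expTower j q ≤ expTower j (C * q) := by
  induction j with
  | zero => rfl
  | succ j ih =>
    rw [expTower_succ', expTower_succ']
    have h1 : 1 ≤ expTower j q := hq.trans (le_expTower j q)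
    calc C * 2 ^ expTower j q ≤ 2 ^ (C - 1) * 2 ^ expTower j q := by
          gcongr
          have := Nat.lt_two_pow_self (n := C - 1)
          omega
      _ = 2 ^ (C - 1 + expTower j q) := (pow_add _ _ _).symm
      _ ≤ 2 ^ (C * expTower j q) := by
          apply Nat.pow_le_pow_right (by norm_num)
          obtain ⟨c, rfl⟩ : ∃ c, C = c + 1 := ⟨C - 1, by omega⟩
          simp only [Nat.add_sub_cancel]
          nlinarith
      _ ≤ 2 ^ expTower j (C * q) := Nat.pow_le_pow_right (by norm_num) ih

theorem logStar_of_le_one {x : ℝ} (h : x ≤ 1) : logStar x = 0 := by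
  rw [logStar, dif_pos h]

theorem logStar_of_one_lt {x : ℝ} (h : 1 < x) : logStar x = 1 + logStar (Real.logb 2 x) := by
  rw [logStar, dif_neg (not_le.mpr h)]

theorem logStar_mono {x y : ℝ} (h : x ≤ y) : logStar x ≤ logStar y := by
  induction y using logStar.induct generalizing x with
  | case1 y hy => rw [logStar_of_le_one (h.trans hy)]; exact Nat.zero_le _
  | case2 y hy ih =>
    rcases le_or_gt x 1 with hx | hx
    · rw [logStar_of_le_one hx]; exact Nat.zero_le _
    · rw [logStar_of_one_lt hx, logStar_of_one_lt (not_le.mp hy)]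
      exact Nat.add_le_add_left
        (ih (Real.logb_le_logb_of_le (by norm_num) (by linarith) h)) 1

theorem logStar_two_pow {x : ℕ} (hx : 1 ≤ x) :
    logStar ((2 ^ x : ℕ) : ℝ) = 1 + logStar (x : ℝ) := by
  rw [logStar_of_one_lt (by exact_mod_cast Nat.one_lt_two_pow (by omega))]
  congr 2
  push_cast
  rw [Real.logb_pow, Real.logb_self_eq_one (by norm_num), mul_one]

theorem logStar_two_pow_le (x : ℕ) : logStar ((2 ^ x : ℕ) : ℝ) ≤ 1 + logStar (x : ℝ) := by
  rcases Nat.eq_zero_or_pos x with rfl | hx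
  · rw [logStar_of_le_one (by norm_num)]; exact Nat.zero_le _
  · exact (logStar_two_pow hx).le

theorem logStar_natCast_le (n : ℕ) : logStar (n : ℝ) ≤ n := by
  induction n with
  | zero => rw [logStar_of_le_one (by norm_num)]
  | succ n ih =>
    have h : ((n + 1 : ℕ) : ℝ) ≤ ((2 ^ n : ℕ) : ℝ) := by exact_mod_cast Nat.lt_two_pow_self
    have := (logStar_mono h).trans (logStar_two_pow_le n)
    omega

theorem logStar_expTower_le (j q : ℕ) :
    logStar (expTower j q : ℝ) ≤ j + logStar (q : ℝ) := by
  induction j with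
  | zero => simp [expTower_zero]
  | succ j ih =>
    rw [expTower_succ']
    have := logStar_two_pow_le (expTower j q)
    omega

theorem le_logStar_expTower (j : ℕ) : j ≤ logStar (expTower j 1 : ℝ) := by
  induction j with
  | zero => exact Nat.zero_le _
  | succ j ih =>
    rw [expTower_succ', logStar_two_pow (le_expTower j 1)]
    omega

/-! ### Monochromatic monotone paths -/

/-- A proper colouring with `q` colours of the shift graph on the increasing `(k + 1)`-tuples from
`S` bounds the size of `S`. The set of colours of the tuples obtained by putting an element in
front of a `k`-tuple is a proper colouring of the `k`-tuples, which costs one exponential;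
for `1`-tuples, the shift graph is complete. -/
theorem card_le_of_shift_colouring (S : Finset ℕ) (k : ℕ) {Γ : Type} [Fintype Γ]
    (φ : List ℕ → Γ)
    (hφ : ∀ l : List ℕ, l.length = k + 2 → l.Pairwise (· < ·) → (∀ a ∈ l, a ∈ S) →
      φ l.dropLast ≠ φ l.tail) :
    S.card ≤ expTower k (Fintype.card Γ) := by
  classical
  induction k generalizing Γ with
  | zero =>
    rw [expTower_zero, ← Fintype.card_coe]
    refine Fintype.card_le_of_injective (fun a : S => φ [a.1]) ?_
    have key : ∀ a b : S, a.1 < b.1 → φ [a.1] ≠ φ [b.1] := fun a b hab => by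
      have := hφ [a.1, b.1] rfl (by simpa using hab) (by simp)
      simpa using this
    intro a b hab
    rcases lt_trichotomy a.1 b.1 with h | h | h
    · exact absurd hab (key a b h)
    · exact Subtype.ext h
    · exact absurd hab.symm (key b a h)
  | succ k ih =>
    rw [expTower_succ, ← Fintype.card_set]
    refine ih (Γ := Set Γ)
      (fun l => {γ | ∃ y, (y :: l).Pairwise (· < ·) ∧ y ∈ S ∧ φ (y :: l) = γ}) ?_
    intro l hl hlt hS heq
    obtain ⟨x, l', rfl⟩ : ∃ x l', l = x :: l' := by
      cases l with
      | nil => simp at hl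
      | cons x l' => exact ⟨x, l', rfl⟩
    have hmem : φ (x :: l') ∈ {γ | ∃ y, (y :: (x :: l').tail).Pairwise (· < ·) ∧ y ∈ S ∧
        φ (y :: (x :: l').tail) = γ} := ⟨x, hlt, hS x (by simp), rfl⟩
    rw [← heq] at hmem
    obtain ⟨y, hy, hyS, hyφ⟩ := hmem
    have hne : l' ≠ [] := by rintro rfl; simp at hl
    have hxl : (x :: l').dropLast = x :: l'.dropLast := List.dropLast_cons_of_ne_nil hne
    have hyx : (y :: x :: l').Pairwise (· < ·) := by
      rw [hxl, List.pairwise_cons] at hy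
      have hyx := hy.1 x (by simp)
      rw [List.pairwise_cons]
      refine ⟨fun a ha => ?_, hlt⟩
      rcases List.mem_cons.mp ha with rfl | ha
      · exact hyx
      · exact hyx.trans ((List.pairwise_cons.mp hlt).1 a ha)
    refine hφ (y :: x :: l') (by simp at hl ⊢; omega) hyx ?_ ?_
    · intro a ha
      rcases List.mem_cons.mp ha with rfl | ha
      · exact hyS
      · exact hS a ha
    · simpa [List.dropLast_cons_of_ne_nil] using hyφ

/-- `P` is an increasing list of elements of `S` in which all `w` consecutive entries have the
colour `γ` under the colouring `c` of lists. -/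
structure IsMonoPath {Γ : Type} (S : Finset ℕ) (c : List ℕ → Γ) (w : ℕ) (γ : Γ) (P : List ℕ) :
    Prop where
  pairwise : P.Pairwise (· < ·)
  mem : ∀ a ∈ P, a ∈ S
  colour : ∀ l, l <:+: P → l.length = w → c l = γ

theorem IsMonoPath.of_infix {Γ : Type} {S : Finset ℕ} {c : List ℕ → Γ} {w : ℕ} {γ : Γ}
    {P Q : List ℕ} (h : IsMonoPath S c w γ P) (hQ : Q <:+: P) : IsMonoPath S c w γ Q :=
  ⟨h.pairwise.sublist hQ.sublist, fun a ha => h.mem a (hQ.subset ha),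
    fun l hl hw => h.colour l (hl.trans hQ) hw⟩

/-- A colouring of the increasing `(k + 2)`-tuples from a set larger than a tower of height `k`
has a monochromatic monotone path with `s` vertices. Otherwise, recording for each
`(k + 1)`-tuple and each colour the length of a longest monochromatic path that begins with the
tuple would give a proper colouring of the shift graph. -/
theorem exists_isMonoPath {Γ : Type} [Fintype Γ] (S : Finset ℕ) (k s : ℕ) (hs : 0 < s)
    (c : List ℕ → Γ) (hS : expTower k (s ^ Fintype.card Γ) < S.card) :
    ∃ γ P, IsMonoPath S c (k + 2) γ P ∧ P.length = s := by
  classical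
  by_contra hno
  push Not at hno
  have hlt : ∀ γ P, IsMonoPath S c (k + 2) γ P → P.length < s := by
    intro γ P hP
    by_contra hle
    refine hno γ (P.take s) (hP.of_infix (List.take_prefix s P).isInfix) ?_
    rw [List.length_take]; omega
  let Q : List ℕ → Γ → ℕ → Prop := fun l γ j =>
    ∃ P, IsMonoPath S c (k + 2) γ P ∧ l <+: P ∧ P.length = j
  let len : List ℕ → Γ → ℕ := fun l γ => Nat.findGreatest (Q l γ) (s - 1)
  have hlen : ∀ l γ, len l γ < s := fun l γ => by
    have := Nat.findGreatest_le (P := Q l γ) (s - 1)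
    simp only [len]; omega
  refine absurd hS (not_lt.mpr ?_)
  have hcard : Fintype.card (Γ → Fin s) = s ^ Fintype.card Γ := by simp
  rw [← hcard]
  refine card_le_of_shift_colouring S k (fun l γ => (⟨len l γ, hlen l γ⟩ : Fin s)) ?_
  intro l hl hlp hlS heq
  obtain ⟨x, l', rfl⟩ : ∃ x l', l = x :: l' := by
    cases l with
    | nil => simp at hl
    | cons x l' => exact ⟨x, l', rfl⟩
  have hl' : l'.length = k + 1 := by simpa using hl
  have heq' : len (x :: l').dropLast (c (x :: l')) = len l' (c (x :: l')) :=
    congrArg Fin.val (congrFun heq (c (x :: l')))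
  -- A longest path that begins with `l.tail` is extended by the head of `l`.
  have hQ : ∃ j, j ≤ s - 1 ∧ Q l' (c (x :: l')) j := by
    have hm : IsMonoPath S c (k + 2) (c (x :: l')) l' :=
      ⟨(List.pairwise_cons.mp hlp).2, fun a ha => hlS a (by simp [ha]), fun m hm hmw => by
        have := hm.length_le; omega⟩
    exact ⟨_, Nat.le_sub_one_of_lt (hlt _ _ hm), l', hm, List.prefix_rfl, rfl⟩
  obtain ⟨j, hj, hQj⟩ := hQ
  obtain ⟨P, hP, hlP, hPl⟩ : Q l' (c (x :: l')) (len l' (c (x :: l'))) :=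
    Nat.findGreatest_spec hj hQj
  have hne : P ≠ [] := by
    rintro rfl
    have := hlP.length_le
    rw [hl', List.length_nil] at this
    omega
  have hxP : IsMonoPath S c (k + 2) (c (x :: l')) (x :: P) := by
    refine ⟨?_, ?_, ?_⟩
    · obtain ⟨tl, rfl⟩ := hlP
      cases l' with
      | nil => simp at hl'
      | cons y l'' =>
        rw [List.pairwise_cons]
        refine ⟨fun a ha => ?_, hP.pairwise⟩
        have hxy : x < y := (List.pairwise_cons.mp hlp).1 y (by simp)
        rw [List.cons_append] at ha
        rcases List.mem_cons.mp ha with rfl | ha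
        · exact hxy
        · have := hP.pairwise
          rw [List.cons_append, List.pairwise_cons] at this
          exact hxy.trans (this.1 a ha)
    · intro a ha
      rcases List.mem_cons.mp ha with rfl | ha
      · exact hlS a (by simp)
      · exact hP.mem a ha
    · intro m hm hmw
      rcases List.infix_cons_iff.mp hm with h | h
      · have h2 : x :: l' <+: x :: P := (List.cons_prefix_cons).mpr ⟨rfl, hlP⟩
        have : m = x :: l' :=
          (List.prefix_of_prefix_length_le h h2 (by omega)).eq_of_length (by omega)
        rw [this]
      · exact hP.colour m h hmw
  have hle : (x :: P).length ≤ len (x :: l').dropLast (c (x :: l')) := by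
    refine Nat.le_findGreatest (Nat.le_sub_one_of_lt (hlt _ _ hxP)) ⟨x :: P, hxP, ?_, rfl⟩
    exact (List.dropLast_prefix _).trans ((List.cons_prefix_cons).mpr ⟨rfl, hlP⟩)
  rw [heq', List.length_cons] at hle
  omega

/-- If every set of at least `N` numbers contains a monochromatic monotone path with `s` vertices,
then the numbers below `m` can be arranged such that all but fewer than `N` of them are grouped
into blocks which are such paths. The blocks are extracted greedily. -/
theorem exists_arrangement {Γ : Type} (m s N w : ℕ) (hs : 0 < s) (c : List ℕ → Γ)
    (hN : ∀ S : Finset ℕ, N ≤ S.card → ∃ γ P, IsMonoPath S c w γ P ∧ P.length = s) :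
    ∃ (K : ℕ) (σ : Equiv.Perm (Fin m)), s * K ≤ m ∧ m < s * K + N ∧
      ∀ j < K, ∃ γ P, P.length = s ∧ (∀ l, l <:+: P → l.length = w → c l = γ) ∧
        ∀ i : Fin m, i.1 / s = j → P[i.1 % s]? = some (σ i).1 := by
  classical
  have greedy : ∀ K, (K = 0 ∨ s * (K - 1) + N ≤ m) →
      ∃ f : ℕ → ℕ, (∀ i < s * K, f i < m) ∧ Set.InjOn f (Finset.range (s * K)) ∧
      ∀ j < K, ∃ γ P, P.length = s ∧ (∀ l, l <:+: P → l.length = w → c l = γ) ∧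
        ∀ i, i / s = j → P[i % s]? = some (f i) := by
    intro K
    induction K with
    | zero => exact fun _ => ⟨id, by simp, by simp, by simp⟩
    | succ K ih =>
      intro hK
      have hKN : s * K + N ≤ m := by simpa using hK
      obtain ⟨f, hfm, hfi, hfP⟩ := ih (by
        rcases Nat.eq_zero_or_pos K with h | h
        · exact Or.inl h
        · right
          have : s * (K - 1) ≤ s * K := Nat.mul_le_mul_left _ (by omega)
          omega)
      obtain ⟨γ, P, hP, hPs⟩ := hN (Finset.range m \ (Finset.range (s * K)).image f) (by
        have h1 := Finset.le_card_sdiff ((Finset.range (s * K)).image f) (Finset.range m)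
        have h2 : ((Finset.range (s * K)).image f).card ≤ s * K := by
          simpa using Finset.card_image_le (s := Finset.range (s * K)) (f := f)
        rw [Finset.card_range] at h1
        omega)
      have hPmem : ∀ k, k < s → ∃ a, P[k]? = some a ∧ a < m ∧ ∀ i < s * K, f i ≠ a := by
        intro k hk
        have hk' : k < P.length := by omega
        have := hP.mem P[k] (List.getElem_mem hk')
        simp only [Finset.mem_sdiff, Finset.mem_range, Finset.mem_image, not_exists, not_and]
          at this
        exact ⟨P[k], List.getElem?_eq_getElem hk', this.1, this.2⟩
      have hnd : P.Nodup := hP.pairwise.imp fun h => h.ne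
      have hdiv : ∀ i, ¬ i < s * K → i < s * (K + 1) → i / s = K := fun i h1 h2 =>
        Nat.div_eq_of_lt_le (by rw [mul_comm]; omega) (by rw [mul_comm]; exact h2)
      have hlt : ∀ i, i / s < K → i < s * K := fun i hi => by
        rw [mul_comm]; exact (Nat.div_lt_iff_lt_mul hs).mp hi
      refine ⟨fun i => if i < s * K then f i else P[i % s]?.getD 0, ?_, ?_, ?_⟩
      · intro i hi
        dsimp only
        split_ifs with h
        · exact hfm i h
        · obtain ⟨a, ha, ham, -⟩ := hPmem (i % s) (Nat.mod_lt _ hs)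
          rw [ha]; exact ham
      · intro i hi i' hi' heq
        simp only [Finset.coe_range, Set.mem_Iio] at hi hi'
        dsimp only at heq
        obtain ⟨a, ha, -, haf⟩ := hPmem (i % s) (Nat.mod_lt _ hs)
        obtain ⟨a', ha', -, haf'⟩ := hPmem (i' % s) (Nat.mod_lt _ hs)
        split_ifs at heq with h h' h'
        · exact hfi (by simpa using h) (by simpa using h') heq
        · rw [ha'] at heq
          exact absurd heq (haf' i h)
        · rw [ha] at heq
          exact absurd heq.symm (haf i' h')
        · rw [ha, ha'] at heq
          have h1 : P[i % s]? = P[i' % s]? := by rw [ha, ha']; exact congrArg some heq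
          have h2 : i % s = i' % s :=
            (List.getElem?_inj (by rw [hPs]; exact Nat.mod_lt _ hs) hnd).mp h1
          rw [← Nat.div_add_mod i s, ← Nat.div_add_mod i' s, h2, hdiv i h hi, hdiv i' h' hi']
      · intro j hj
        rcases Nat.lt_succ_iff_lt_or_eq.mp hj with hj | rfl
        · obtain ⟨γ', P', h1, h2, h3⟩ := hfP j hj
          refine ⟨γ', P', h1, h2, fun i hi => ?_⟩
          dsimp only
          rw [if_pos (hlt i (by omega))]
          exact h3 i hi
        · refine ⟨γ, P, hPs, hP.colour, fun i hi => ?_⟩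
          have : ¬ i < s * j := by
            rw [mul_comm, ← Nat.div_lt_iff_lt_mul hs]; omega
          dsimp only
          rw [if_neg this]
          obtain ⟨a, ha, -, -⟩ := hPmem (i % s) (Nat.mod_lt _ hs)
          rw [ha]; rfl
  obtain ⟨K, hK, hmK⟩ : ∃ K, (K = 0 ∨ s * (K - 1) + N ≤ m) ∧ m < s * K + N := by
    rcases lt_or_ge m N with h | h
    · exact ⟨0, Or.inl rfl, by omega⟩
    · refine ⟨(m - N) / s + 1, Or.inr ?_, ?_⟩
      · have := Nat.mul_div_le (m - N) s
        rw [Nat.add_sub_cancel]; omega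
      · have := Nat.lt_mul_div_succ (m - N) hs
        omega
  obtain ⟨f, hfm, hfi, hfP⟩ := greedy K hK
  have hKm : s * K ≤ m := by
    have := Finset.card_le_card_of_injOn (t := Finset.range m) f
      (fun i hi => by simpa using hfm i (by simpa using hi)) hfi
    simpa using this
  let F : Fin m → Fin m := fun i => if h : i.1 < s * K then ⟨f i, hfm i h⟩ else i
  have hF : ∀ i : Fin m, i.1 < s * K → (F i).1 = f i := fun i h => by simp [F, h]
  obtain ⟨g, hg⟩ := Finset.exists_equiv_extend_of_card_eq (α := Fin m) (t := Finset.univ)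
    (by simp) (s := Finset.univ.filter fun i : Fin m => i.1 < s * K) (f := F)
    (Finset.subset_univ _) (by
      intro i hi i' hi' heq
      have hi : i.1 < s * K := by simpa using hi
      have hi' : i'.1 < s * K := by simpa using hi'
      have := congrArg Fin.val heq
      rw [hF i hi, hF i' hi'] at this
      exact Fin.ext (hfi (by simpa using hi) (by simpa using hi') this))
  refine ⟨K, g.trans (Equiv.subtypeUnivEquiv fun i => Finset.mem_univ i), hKm, hmK,
    fun j hj => ?_⟩
  obtain ⟨γ, P, h1, h2, h3⟩ := hfP j hj
  refine ⟨γ, P, h1, h2, fun i hi => ?_⟩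
  have hiK : i.1 < s * K := by
    rw [mul_comm]; exact (Nat.div_lt_iff_lt_mul hs).mp (by omega)
  rw [h3 i hi, ← hF i hiK, ← hg i (by simpa using hiK)]
  rfl

/-! ### The strip -/

/-- The differences between the columns of the ends of an edge, as a function of the port `p`:
they are `±1, ±3, …`, and also `0` if `d` is odd. -/
def offset (d : ℕ) (p : Fin d) : ℤ :=
  if 2 * p.1 + 1 < d then 2 * ((p.1 : ℤ) - (d / 2 : ℕ)) + 1
  else if 2 * p.1 + 1 = d then 0
  else 2 * ((p.1 : ℤ) + (d / 2 : ℕ) - d) + 1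

theorem offset_rev {d : ℕ} (p : Fin d) : offset d p.rev = -offset d p := by
  have := p.2
  simp only [offset, Fin.val_rev]
  split_ifs <;> omega

theorem offset_injective (d : ℕ) : Function.Injective (offset d) := by
  intro p q h
  have := p.2
  have := q.2
  simp only [offset] at h
  apply Fin.ext
  split_ifs at h <;> omega

theorem abs_offset_le {d : ℕ} (p : Fin d) : |offset d p| ≤ d := by
  have := p.2
  rw [abs_le]
  simp only [offset]
  split_ifs <;> omega

theorem offset_eq_zero_iff {d : ℕ} (p : Fin d) : offset d p = 0 ↔ 2 * p.1 + 1 = d := by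
  have := p.2
  simp only [offset]
  split_ifs <;> omega

theorem offset_emod_two {d : ℕ} {p : Fin d} (h : offset d p ≠ 0) : offset d p % 2 = 1 := by
  have := p.2
  simp only [offset] at h ⊢
  split_ifs at h ⊢ <;> omega

/-- The strand that is reached through port `p` from strand `c`: the edges within a column lead to
the other strand, and all others stay in the strand. -/
def nextStrand {d : ℕ} (p : Fin d) (c : Bool) : Bool := c ^^ decide (offset d p = 0)

theorem nextStrand_of_ne {d : ℕ} {p : Fin d} (h : offset d p ≠ 0) (c : Bool) :
    nextStrand p c = c := by
  simp [nextStrand, h]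

namespace LocalAlgorithm

variable (A : LocalAlgorithm.{u}) (n d : ℕ)

/-- The states of `A` on the infinite strip, whose vertices are the pairs of a column in `ℤ` and a
strand in `Bool`, with the identifiers `id`. The vertices are told that the graph has `n` vertices,
and port `p` of each vertex is joined to port `p.rev` of the vertex in strand `nextStrand p c` at
distance `offset d p`. -/
def stripState (id : ℤ → Bool → ℕ) : ℕ → ℤ → Bool → A.State
  | 0, i, c => A.init n d (id i c)
  | t + 1, i, c => A.recv (stripState id t i c) (List.ofFn fun p : Fin d =>
      A.send (stripState id t (i + offset d p) (nextStrand p c)) p.rev.1)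

/-- The irrevocable decisions of `A` on the infinite strip. -/
def stripDecision (id : ℤ → Bool → ℕ) : ℕ → ℤ → Bool → Option Bool
  | 0, i, c => A.output (A.stripState n d id 0 i c)
  | t + 1, i, c =>
      (stripDecision id t i c).orElse fun _ => A.output (A.stripState n d id (t + 1) i c)

variable {n d}

/-- The run on the strip is local and invariant under translations. -/
theorem stripState_congr {id id' : ℤ → Bool → ℕ} (t : ℕ) {i i' : ℤ} (c : Bool)
    (h : ∀ z : ℤ, |z| ≤ t * d → ∀ c, id (i + z) c = id' (i' + z) c) :
    A.stripState n d id t i c = A.stripState n d id' t i' c := by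
  induction t generalizing i i' c with
  | zero =>
    have := h 0 (by simp) c
    simp only [add_zero] at this
    simp only [stripState, this]
  | succ t ih =>
    have hd : ((t + 1 : ℕ) : ℤ) * d = t * d + d := by push_cast; ring
    rw [hd] at h
    simp only [stripState]
    congr 1
    · exact ih c fun z hz => h z (by omega)
    · congr 1
      funext p
      congr 1
      refine ih _ fun z hz c => ?_
      rw [add_assoc, add_assoc]
      refine h _ ?_ c
      have := abs_add_le (offset d p) z
      have := abs_offset_le p
      omega

theorem stripDecision_congr {id id' : ℤ → Bool → ℕ} (t : ℕ) {i i' : ℤ} (c : Bool)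
    (h : ∀ z : ℤ, |z| ≤ t * d → ∀ c, id (i + z) c = id' (i' + z) c) :
    A.stripDecision n d id t i c = A.stripDecision n d id' t i' c := by
  induction t with
  | zero => exact congrArg A.output (A.stripState_congr 0 c h)
  | succ t ih =>
    simp only [stripDecision]
    rw [A.stripState_congr (t + 1) c h, ih fun z hz => h z (hz.trans ?_)]
    push_cast
    nlinarith

theorem decision_mono {G : SimpleGraph (Fin n)} [DecidableRel G.Adj] {B : ℕ} (L : Labelling G B)
    {t t' : ℕ} (htt : t ≤ t') {v : Fin n} {b : Bool} (h : A.decision L t v = some b) :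
    A.decision L t' v = some b := by
  induction t', htt using Nat.le_induction with
  | base => exact h
  | succ t' _ ih => simp [decision, ih]

end LocalAlgorithm

/-! ### The closed band -/

section Band

variable {n d m : ℕ} (e : Fin n ≃ ZMod m × Bool)

/-- The vertex at the end of the edge that leaves `v` through port `p`. -/
def bandNeighbor (v : Fin n) (p : Fin d) : Fin n :=
  e.symm ((e v).1 + (offset d p : ℤ), !(e v).2)

theorem bandNeighbor_rev (v : Fin n) (p : Fin d) :
    bandNeighbor e (bandNeighbor e v p) p.rev = v := by
  simp [bandNeighbor, offset_rev]

/-- The graph on `ZMod m × Bool` in which `(i, b)` is adjacent to `(i + o, !b)` for all offsets `o`,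
carried over to `Fin n`. It is a quotient of the strip. -/
def bandGraph (d : ℕ) : SimpleGraph (Fin n) where
  Adj v w := ∃ p : Fin d, w = bandNeighbor e v p
  symm := ⟨by
    rintro v w ⟨p, rfl⟩
    exact ⟨p.rev, (bandNeighbor_rev e v p).symm⟩⟩
  loopless := ⟨by
    rintro v ⟨p, hp⟩
    have := congrArg (fun v => (e v).2) hp
    simp [bandNeighbor] at this⟩

noncomputable instance : DecidableRel (bandGraph e d).Adj := Classical.decRel _

theorem isBipartite_bandGraph : (bandGraph e d).IsBipartite := by
  refine ⟨SimpleGraph.Coloring.mk (fun v => if (e v).2 then 1 else 0) ?_⟩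
  rintro v w ⟨p, rfl⟩
  simp only [bandNeighbor, Equiv.apply_symm_apply]
  cases (e v).2 <;> simp

theorem bandNeighbor_injective (hm : 2 * d < m) (v : Fin n) :
    Function.Injective (bandNeighbor (d := d) e v) := by
  intro p q h
  have h1 := e.symm.injective h
  simp only [Prod.mk.injEq, add_right_inj, and_true] at h1
  rw [ZMod.intCast_eq_intCast_iff_dvd_sub] at h1
  have hp := abs_le.mp (abs_offset_le p)
  have hq := abs_le.mp (abs_offset_le q)
  refine offset_injective d ?_
  have := Int.eq_zero_of_abs_lt_dvd h1 (by rw [abs_lt]; omega)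
  omega

/-- The ports of the band: port `p` leads to `bandNeighbor e v p`. -/
noncomputable def bandPort (hm : 2 * d < m) (v : Fin n) :
    Fin d ≃ (bandGraph e d).neighborSet v :=
  Equiv.ofBijective (fun p => ⟨bandNeighbor e v p, p, rfl⟩)
    ⟨fun _ _ h => bandNeighbor_injective e hm v (congrArg Subtype.val h),
      fun ⟨_, p, hp⟩ => ⟨p, Subtype.ext hp.symm⟩⟩

theorem degree_bandGraph (hm : 2 * d < m) (v : Fin n) : (bandGraph e d).degree v = d := by
  rw [← SimpleGraph.card_neighborSet_eq_degree, ← Fintype.card_congr (bandPort e hm v),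
    Fintype.card_fin]

/-- The band with given identifiers. -/
noncomputable def bandLabelling (hm : 2 * d < m) {B : ℕ} (id : Fin n → ℕ)
    (hid : Function.Injective id) (h1 : ∀ v, 1 ≤ id v) (hB : ∀ v, id v ≤ B) :
    Labelling (bandGraph e d) B where
  ident := id
  ident_injective := hid
  one_le_ident := h1
  ident_le := hB
  port v := (finCongr (degree_bandGraph e hm v)).trans (bandPort e hm v)

/-- The covering map from the strip onto the band. -/
def stripVertex (i : ℤ) (c : Bool) : Fin n :=
  e.symm ((i : ZMod m), c ^^ decide (i % 2 = 1))

theorem bandNeighbor_stripVertex (i : ℤ) (c : Bool) (p : Fin d) :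
    bandNeighbor e (stripVertex e i c) p = stripVertex e (i + offset d p) (nextStrand p c) := by
  simp only [bandNeighbor, stripVertex, Equiv.apply_symm_apply, nextStrand, Int.cast_add]
  congr 2
  by_cases h : offset d p = 0
  · simp [h]
  · have := offset_emod_two h
    rcases Int.emod_two_eq_zero_or_one i with hi | hi
    · have : (i + offset d p) % 2 = 1 := by omega
      simp [h, hi, this]
    · have : (i + offset d p) % 2 = 0 := by omega
      simp [h, hi, this]

variable (A : LocalAlgorithm.{u}) (hm : 2 * d < m) {B : ℕ} {id : Fin n → ℕ}
    (hid : Function.Injective id) (h1 : ∀ v, 1 ≤ id v) (hB : ∀ v, id v ≤ B)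

/-- The run on the band lifts to the run on the strip along the covering map. -/
theorem state_bandLabelling (t : ℕ) (i : ℤ) (c : Bool) :
    A.state (bandLabelling e hm id hid h1 hB) t (stripVertex e i c) =
      A.stripState n d (fun i c => id (stripVertex e i c)) t i c := by
  induction t generalizing i c with
  | zero =>
    simp only [LocalAlgorithm.state, LocalAlgorithm.stripState, degree_bandGraph e hm]
    rfl
  | succ t ih =>
    simp only [LocalAlgorithm.state, LocalAlgorithm.stripState]
    rw [ih, List.ofFn_congr (degree_bandGraph e hm (stripVertex e i c))]
    congr 2
    funext p
    have hport : ((bandLabelling e hm id hid h1 hB).port (stripVertex e i c)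
        (Fin.cast (degree_bandGraph e hm (stripVertex e i c)).symm p)).1 =
        bandNeighbor e (stripVertex e i c) p := rfl
    have hback : ∀ w (h : w ∈ (bandGraph e d).neighborSet (stripVertex e i c)),
        w = bandNeighbor e (stripVertex e i c) p →
        (((bandLabelling e hm id hid h1 hB).port w).symm
          ⟨stripVertex e i c, (bandGraph e d).adj_symm h⟩).1 = p.rev.1 := by
      rintro w h rfl
      have : (bandPort e hm (bandNeighbor e (stripVertex e i c) p)).symm
          ⟨stripVertex e i c, (bandGraph e d).adj_symm h⟩ = p.rev := by
        rw [Equiv.symm_apply_eq]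
        exact Subtype.ext (bandNeighbor_rev e _ p).symm
      exact congrArg Fin.val this
    rw [hback _ (Subtype.prop _) hport, hport, bandNeighbor_stripVertex, ih]

theorem decision_bandLabelling (t : ℕ) (i : ℤ) (c : Bool) :
    A.decision (bandLabelling e hm id hid h1 hB) t (stripVertex e i c) =
      A.stripDecision n d (fun i c => id (stripVertex e i c)) t i c := by
  induction t with
  | zero => exact congrArg A.output (state_bandLabelling e A hm hid h1 hB 0 i c)
  | succ t ih =>
    simp only [LocalAlgorithm.decision, LocalAlgorithm.stripDecision]
    rw [ih, state_bandLabelling]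

/-- Every edge of the band is the image of exactly one edge of the strip that starts at a vertex
`(i, c)` with `0 ≤ i < m`, where `c` is the strand over the side `false` of the bipartition. -/
theorem cutSize_bandGraph_le [NeZero m] (x : Fin n → Bool) :
    cutSize (bandGraph e d) x ≤
      ((Finset.univ : Finset (Fin m × Fin d)).filter fun ip =>
        x (stripVertex e (ip.1.1 : ℤ) (decide ((ip.1.1 : ℤ) % 2 = 1))) ≠
        x (stripVertex e ((ip.1.1 : ℤ) + offset d ip.2)
          (nextStrand ip.2 (decide ((ip.1.1 : ℤ) % 2 = 1))))).card := by
  classical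
  let f : Fin m × Fin d → Sym2 (Fin n) := fun ip =>
    s(stripVertex e (ip.1.1 : ℤ) (decide ((ip.1.1 : ℤ) % 2 = 1)),
      stripVertex e ((ip.1.1 : ℤ) + offset d ip.2)
        (nextStrand ip.2 (decide ((ip.1.1 : ℤ) % 2 = 1))))
  have key : ∀ v w : Fin n, (e v).2 = false → (bandGraph e d).Adj v w → x v ≠ x w →
      ∃ ip : Fin m × Fin d, x (stripVertex e (ip.1.1 : ℤ) (decide ((ip.1.1 : ℤ) % 2 = 1))) ≠
        x (stripVertex e ((ip.1.1 : ℤ) + offset d ip.2)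
          (nextStrand ip.2 (decide ((ip.1.1 : ℤ) % 2 = 1)))) ∧ f ip = s(v, w) := by
    rintro v w hv ⟨p, rfl⟩ hx
    have hsv : stripVertex e (((e v).1.val : ℕ) : ℤ)
        (decide ((((e v).1.val : ℕ) : ℤ) % 2 = 1)) = v := by
      simp only [stripVertex, Bool.xor_self, Int.cast_natCast, ZMod.natCast_zmod_val]
      rw [Equiv.symm_apply_eq, ← hv]
    refine ⟨(⟨(e v).1.val, ZMod.val_lt _⟩, p), ?_, ?_⟩
    · dsimp only
      rw [← bandNeighbor_stripVertex, hsv]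
      exact hx
    · simp only [f]
      rw [← bandNeighbor_stripVertex, hsv]
  rw [cutSize, ← Set.ncard_coe_finset]
  refine (Set.ncard_le_ncard (t := f '' _) ?_ (Set.toFinite _)).trans
    (Set.ncard_image_le (Set.toFinite _))
  rintro _ ⟨hadj, v, w, rfl, hxv, hxw⟩
  have hadj : (bandGraph e d).Adj v w := hadj
  have hside : (e w).2 = !(e v).2 := by
    obtain ⟨p, rfl⟩ := hadj
    simp [bandNeighbor]
  cases hv : (e v).2 with
  | false =>
    obtain ⟨ip, h1, h2⟩ := key v w hv hadj (by simp [hxv, hxw])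
    exact ⟨ip, by simpa using h1, h2⟩
  | true =>
    obtain ⟨ip, h1, h2⟩ := key w v (by simp [hside, hv]) hadj.symm (by simp [hxv, hxw])
    exact ⟨ip, by simpa using h1, by rw [h2, Sym2.eq_swap]⟩

/-- The sides of the bipartition form a cut that contains all edges. -/
theorem le_maxCut_bandGraph [NeZero m] (hm : 2 * d < m) : m * d ≤ maxCut (bandGraph e d) := by
  classical
  refine le_trans ?_ (Finset.le_sup (Finset.mem_univ fun v => (e v).2))
  let f : ZMod m × Fin d → Sym2 (Fin n) := fun ip =>
    s(e.symm (ip.1, false), bandNeighbor e (e.symm (ip.1, false)) ip.2)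
  have hf : Function.Injective f := by
    rintro ⟨i, p⟩ ⟨j, q⟩ h
    rcases Sym2.eq_iff.mp h with ⟨h1, h2⟩ | ⟨h1, -⟩
    · have hij : i = j := by simpa using h1
      subst hij
      exact Prod.ext rfl (bandNeighbor_injective e hm _ h2)
    · have := congrArg (fun v => (e v).2) h1
      simp [bandNeighbor] at this
  calc m * d = (Set.range f).ncard := by
        rw [Set.ncard_eq_toFinset_card', Set.toFinset_range,
          Finset.card_image_of_injective _ hf, Finset.card_univ]
        simp [ZMod.card]
    _ ≤ _ := by
        refine Set.ncard_le_ncard ?_ (Set.toFinite _)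
        rintro _ ⟨⟨i, p⟩, rfl⟩
        exact ⟨⟨p, rfl⟩, _, _, rfl, by simp, by simp [bandNeighbor]⟩

end Band

/-! ### The cut computed on a band with arranged identifiers -/

/-- The identifiers of the band in which column `i` holds `2 σ(i) + 1` and `2 σ(i) + 2`, in the
order of the strands. -/
def bandIdent {n m : ℕ} [NeZero m] (e : Fin n ≃ ZMod m × Bool) (σ : Equiv.Perm (Fin m))
    (v : Fin n) : ℕ :=
  2 * (σ ⟨(e v).1.val, ZMod.val_lt _⟩).1 +
    ((e v).2 ^^ decide (((e v).1.val : ℤ) % 2 = 1)).toNat + 1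

section Band

variable {n m : ℕ} [NeZero m] (e : Fin n ≃ ZMod m × Bool) (σ : Equiv.Perm (Fin m))

theorem bandIdent_injective : Function.Injective (bandIdent e σ) := by
  intro v w h
  simp only [bandIdent] at h
  have h1 := Bool.toNat_le ((e v).2 ^^ decide (((e v).1.val : ℤ) % 2 = 1))
  have h2 := Bool.toNat_le ((e w).2 ^^ decide (((e w).1.val : ℤ) % 2 = 1))
  have h3 : σ ⟨(e v).1.val, ZMod.val_lt _⟩ = σ ⟨(e w).1.val, ZMod.val_lt _⟩ :=
    Fin.ext (by omega)
  have h4 : (e v).1.val = (e w).1.val := congrArg Fin.val (σ.injective h3)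
  have h5 := (by decide : ∀ a b : Bool, a.toNat = b.toNat → a = b) _ _
    (show ((e v).2 ^^ decide (((e v).1.val : ℤ) % 2 = 1)).toNat =
      ((e w).2 ^^ decide (((e w).1.val : ℤ) % 2 = 1)).toNat by omega)
  rw [h4] at h5
  exact e.injective (Prod.ext (ZMod.val_injective m h4) (by simpa using h5))

theorem one_le_bandIdent (v : Fin n) : 1 ≤ bandIdent e σ v := by
  simp [bandIdent]

theorem bandIdent_le (v : Fin n) : bandIdent e σ v ≤ 2 * m := by
  have h1 := Bool.toNat_le ((e v).2 ^^ decide (((e v).1.val : ℤ) % 2 = 1))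
  have h2 := (σ ⟨(e v).1.val, ZMod.val_lt _⟩).2
  simp only [bandIdent]
  omega

theorem bandIdent_stripVertex (i : Fin m) (c : Bool) :
    bandIdent e σ (stripVertex e (i.1 : ℤ) c) = 2 * (σ i).1 + c.toNat + 1 := by
  simp [bandIdent, stripVertex, Nat.mod_eq_of_lt i.2]

end Band

/-- The identifiers on the strip if column `i` takes its two identifiers from entry `i` of `l`. -/
def listIdent (l : List ℕ) (i : ℤ) (c : Bool) : ℕ := 2 * l.getD i.toNat 0 + c.toNat + 1

/-- The sides announced within `t` rounds in the two strands of the middle column of a window of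
`2 * r + 1` columns with identifiers from `l`. -/
def LocalAlgorithm.windowColour (A : LocalAlgorithm.{u}) (n d t r : ℕ) (l : List ℕ) :
    Bool → Bool :=
  fun c => (A.stripDecision n d (listIdent l) t r c).getD false

/-- Within a monochromatic block, the announced side depends only on the strand. -/
theorem stripDecision_eq_of_block (A : LocalAlgorithm.{u}) {n m d t r s : ℕ} [NeZero m]
    (e : Fin n ≃ ZMod m × Bool) (σ : Equiv.Perm (Fin m)) (hr : t * d ≤ r) {γ : Bool → Bool}
    {P : List ℕ} (hPs : P.length = s)
    (hPγ : ∀ l, l <:+: P → l.length = 2 * r + 1 → A.windowColour n d t r l = γ)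
    {j : ℕ} (hj : s * (j + 1) ≤ m) (hP : ∀ i : Fin m, i.1 / s = j → P[i.1 % s]? = some (σ i).1)
    {k : ℕ} (hk1 : r ≤ k) (hk2 : k + r < s) (c : Bool) :
    (A.stripDecision n d (fun i c => bandIdent e σ (stripVertex e i c)) t
      ((s * j + k : ℕ) : ℤ) c).getD false = γ c := by
  have hl : ((P.drop (k - r)).take (2 * r + 1)).length = 2 * r + 1 := by
    rw [List.length_take, List.length_drop]; omega
  rw [← hPγ ((P.drop (k - r)).take (2 * r + 1))
    ((List.take_prefix _ _).isInfix.trans (List.drop_suffix _ _).isInfix) hl,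
    LocalAlgorithm.windowColour]
  congr 1
  refine A.stripDecision_congr t c fun z hz c => ?_
  have hzr : |z| ≤ r := hz.trans (by exact_mod_cast hr)
  rw [abs_le] at hzr
  obtain ⟨a, ha⟩ : ∃ a : ℕ, (r : ℤ) + z = a := ⟨((r : ℤ) + z).toNat, by omega⟩
  have hlt : k - r + a < s := by omega
  have hm : s * j + (k - r + a) < m := by rw [mul_add] at hj; omega
  have hi : ((s * j + k : ℕ) : ℤ) + z = ((s * j + (k - r + a) : ℕ) : ℤ) := by omega
  have h1 := hP ⟨s * j + (k - r + a), hm⟩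
    (by simp only; rw [Nat.mul_add_div (by omega), Nat.div_eq_of_lt hlt, add_zero])
  simp only [Nat.mul_add_mod, Nat.mod_eq_of_lt hlt] at h1
  rw [hi, bandIdent_stripVertex e σ ⟨s * j + (k - r + a), hm⟩ c, listIdent, ha, Int.toNat_natCast,
    List.getD_eq_getElem?_getD, List.getElem?_take_of_lt (by omega), List.getElem?_drop, h1]
  rfl

/-- Few positions are outside the `K` blocks of length `s`, or within `ρ` of the end of a block. -/
theorem card_filter_near_ends_le {m s K N ρ : ℕ} (hs : 2 * ρ < s) (hK : s * K ≤ m)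
    (hm : m < s * K + N) :
    ((Finset.univ : Finset (Fin m)).filter fun i =>
      ¬ (i.1 / s < K ∧ ρ ≤ i.1 % s ∧ i.1 % s + ρ < s)).card ≤ N + 2 * ρ * K := by
  classical
  have hgood : K * (s - 2 * ρ) ≤ ((Finset.univ : Finset (Fin m)).filter fun i =>
      i.1 / s < K ∧ ρ ≤ i.1 % s ∧ i.1 % s + ρ < s).card := by
    have hlt : ∀ a : Fin K × Fin (s - 2 * ρ), s * a.1.1 + (ρ + a.2.1) < m := fun a => by
      have h1 := a.2.2
      have h2 : s * (a.1.1 + 1) ≤ s * K := Nat.mul_le_mul_left _ a.1.2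
      rw [mul_add] at h2
      omega
    have hdm : ∀ a : Fin K × Fin (s - 2 * ρ), (s * a.1.1 + (ρ + a.2.1)) / s = a.1.1 ∧
        (s * a.1.1 + (ρ + a.2.1)) % s = ρ + a.2.1 := fun a => by
      have h1 := a.2.2
      have h2 : ρ + a.2.1 < s := by omega
      exact ⟨by rw [Nat.mul_add_div (by omega), Nat.div_eq_of_lt h2, add_zero],
        by rw [Nat.mul_add_mod, Nat.mod_eq_of_lt h2]⟩
    have := Finset.card_le_card_of_injOn (s := (Finset.univ : Finset (Fin K × Fin (s - 2 * ρ))))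
      (t := (Finset.univ : Finset (Fin m)).filter fun i =>
        i.1 / s < K ∧ ρ ≤ i.1 % s ∧ i.1 % s + ρ < s)
      (fun a => ⟨_, hlt a⟩)
      (fun a _ => by
        have h1 := a.2.2
        simp only [Finset.coe_filter, Finset.mem_univ, true_and, Set.mem_ofPred_eq, hdm]
        have := a.1.2
        omega)
      (fun a _ b _ hab => by
        have h := congrArg Fin.val hab
        simp only at h
        have h1 := congrArg (· / s) h
        have h2 := congrArg (· % s) h
        simp only [hdm] at h1 h2
        exact Prod.ext (Fin.ext h1) (Fin.ext (by omega)))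
    simpa using this
  have hsum := Finset.card_filter_add_card_filter_not (s := (Finset.univ : Finset (Fin m)))
    (fun i => i.1 / s < K ∧ ρ ≤ i.1 % s ∧ i.1 % s + ρ < s)
  rw [Finset.card_univ, Fintype.card_fin] at hsum
  have h3 : K * (s - 2 * ρ) + 2 * ρ * K = s * K := by
    obtain ⟨a, rfl⟩ : ∃ a, s = a + 2 * ρ := ⟨s - 2 * ρ, by omega⟩
    rw [Nat.add_sub_cancel]; ring
  omega

theorem card_filter_offset_eq_zero_le (d : ℕ) :
    ((Finset.univ : Finset (Fin d)).filter fun p => offset d p = 0).card ≤ d % 2 := by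
  simp only [offset_eq_zero_iff]
  rcases Nat.mod_two_eq_zero_or_one d with h | h
  · rw [h, Nat.le_zero, Finset.card_eq_zero, Finset.filter_eq_empty_iff]
    intro p _
    omega
  · rw [h, Finset.card_le_one]
    intro p hp q hq
    simp only [Finset.mem_filter, Finset.mem_univ, true_and] at hp hq
    exact Fin.ext (by omega)

/-- On some band with some identifiers, an algorithm that finishes within `t` rounds cuts, besides
the edges within columns (which exist only for odd `d`), only edges near the ends of the blocks
or outside the blocks. -/
theorem exists_labelling_cutSize_le (A : LocalAlgorithm.{u}) {n m d t s B : ℕ} (hn : n = m + m)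
    (hd : 1 ≤ d) (hm : 2 * d < m) (hs : 2 * ((t + 2) * d) < s) (hB : n ≤ B) :
    ∃ (G : SimpleGraph (Fin n)) (_ : DecidableRel G.Adj) (L : Labelling G B) (K : ℕ),
      G.IsBipartite ∧ G.IsRegularOfDegree d ∧ m * d ≤ maxCut G ∧ s * K ≤ m ∧
      (A.FinishedBy L t → ∀ x, A.Computes L x → cutSize G x ≤
        (d % 2) * m + d * (expTower (2 * ((t + 1) * d) - 1) (s ^ 4) + 1 + 2 * ((t + 2) * d) * K)) := by
  classical
  have : NeZero m := ⟨by omega⟩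
  obtain ⟨e⟩ : Nonempty (Fin n ≃ ZMod m × Bool) :=
    ⟨Fintype.equivOfCardEq (by simp [ZMod.card]; omega)⟩
  set r := (t + 1) * d with hr
  set ρ := (t + 2) * d with hρ
  have hρr : ρ = r + d := by rw [hr, hρ]; ring
  have hr1 : 1 ≤ r := Nat.mul_pos (by omega) hd
  obtain ⟨K, σ, hK, hmK, hblock⟩ := exists_arrangement m s (expTower (2 * r - 1) (s ^ 4) + 1)
    (2 * r + 1) (by omega) (A.windowColour n d t r) (fun S hS => by
      have := exists_isMonoPath S (2 * r - 1) s (by omega) (A.windowColour n d t r)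
        (by simpa using hS)
      rwa [show 2 * r - 1 + 2 = 2 * r + 1 by omega] at this)
  refine ⟨bandGraph e d, inferInstance, bandLabelling e hm (bandIdent e σ)
    (bandIdent_injective e σ) (one_le_bandIdent e σ)
    (fun v => (bandIdent_le e σ v).trans (by omega)), K, isBipartite_bandGraph e,
    degree_bandGraph e hm, le_maxCut_bandGraph e hm, hK, fun hfin x hx => ?_⟩
  have hxs : ∀ i c, x (stripVertex e i c) = (A.stripDecision n d
      (fun i c => bandIdent e σ (stripVertex e i c)) t i c).getD false := by
    intro i c
    obtain ⟨t', ht'⟩ := hx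
    obtain ⟨b, hb⟩ := Option.isSome_iff_exists.mp (hfin (stripVertex e i c))
    have h1 := A.decision_mono _ (le_max_left t t') hb
    have h2 := A.decision_mono _ (le_max_right t t') (ht' (stripVertex e i c))
    rw [h1, Option.some_inj] at h2
    rw [← decision_bandLabelling e A hm (bandIdent_injective e σ) (one_le_bandIdent e σ)
      (fun v => (bandIdent_le e σ v).trans (by omega : 2 * m ≤ B)), hb, ← h2]
    rfl
  refine (cutSize_bandGraph_le e x).trans ?_
  have hsub : ((Finset.univ : Finset (Fin m × Fin d)).filter fun ip =>
        x (stripVertex e (ip.1.1 : ℤ) (decide ((ip.1.1 : ℤ) % 2 = 1))) ≠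
        x (stripVertex e ((ip.1.1 : ℤ) + offset d ip.2)
          (nextStrand ip.2 (decide ((ip.1.1 : ℤ) % 2 = 1))))) ⊆
      (Finset.univ ×ˢ Finset.univ.filter fun p => offset d p = 0) ∪
      ((Finset.univ.filter fun i : Fin m =>
        ¬ (i.1 / s < K ∧ ρ ≤ i.1 % s ∧ i.1 % s + ρ < s)) ×ˢ Finset.univ) := by
    rintro ⟨i, p⟩ hip
    simp only [Finset.mem_filter, Finset.mem_univ, true_and] at hip
    simp only [Finset.mem_union, Finset.mem_product, Finset.mem_filter, Finset.mem_univ, true_and,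
      and_true]
    by_contra hcon
    push Not at hcon
    obtain ⟨hp, hj, hi1, hi2⟩ := hcon
    refine hip ?_
    rw [nextStrand_of_ne hp, hxs, hxs]
    obtain ⟨γ, P, hPs, hPγ, hP⟩ := hblock _ hj
    have hjm : s * (i.1 / s + 1) ≤ m := (Nat.mul_le_mul_left _ hj).trans hK
    have htr : t * d ≤ r := Nat.mul_le_mul_right _ (by omega)
    have ho := abs_le.mp (abs_offset_le p)
    have hdm := Nat.div_add_mod i.1 s
    obtain ⟨k, hk⟩ : ∃ k : ℕ, ((i.1 % s : ℕ) : ℤ) + offset d p = k :=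
      ⟨(((i.1 % s : ℕ) : ℤ) + offset d p).toNat, by omega⟩
    have e1 : (i.1 : ℤ) = ((s * (i.1 / s) + i.1 % s : ℕ) : ℤ) := by rw [hdm]
    have e2 : (i.1 : ℤ) + offset d p = ((s * (i.1 / s) + k : ℕ) : ℤ) := by
      rw [e1, Nat.cast_add, add_assoc, hk, ← Nat.cast_add]
    have c1 := stripDecision_eq_of_block A e σ htr hPs hPγ hjm hP (k := i.1 % s)
      (by omega) (by omega) (decide ((i.1 : ℤ) % 2 = 1))
    have c2 := stripDecision_eq_of_block A e σ htr hPs hPγ hjm hP (k := k)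
      (by omega) (by omega) (decide ((i.1 : ℤ) % 2 = 1))
    rw [← e1] at c1
    rw [← e2] at c2
    rw [c1, c2]
  refine (Finset.card_le_card hsub).trans ((Finset.card_union_le _ _).trans ?_)
  rw [Finset.card_product, Finset.card_product, Finset.card_univ, Finset.card_univ,
    Fintype.card_fin, Fintype.card_fin]
  have h1 := card_filter_offset_eq_zero_le d
  have h2 := card_filter_near_ends_le hs hK hmK
  calc _ ≤ m * (d % 2) + (expTower (2 * r - 1) (s ^ 4) + 1 + 2 * ρ * K) * d :=
        Nat.add_le_add (Nat.mul_le_mul_left _ h1) (Nat.mul_le_mul_right _ h2)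
    _ = _ := by ring

/-! ### The lower bound -/

/-- If an algorithm beats the ratio `(d % 2) / d` by `δ` within `t` rounds on graphs with `n`
vertices, then `log* n` is at most linear in `t`. -/
theorem exists_logStar_le (d : ℕ) (hd : 1 ≤ d) (δ : ℝ) (hδ : 0 < δ) :
    ∃ K : ℕ, ∀ B : ℕ → ℕ, (∀ n, n ≤ B n) → ∀ (A : LocalAlgorithm.{u}) (T : ℕ → ℕ),
      A.IsMaxCutApprox d B (((d % 2 : ℕ) : ℝ) / d + δ) → A.RunsIn d B T →
      ∀ n : ℕ, 4 * d < n → Even n → logStar (n : ℝ) ≤ K * (T n + 1) := by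
  set C : ℕ := ⌈8 / δ⌉₊ + 3 with hC
  have hCδ : 8 ≤ C * δ := by
    have h1 : 8 / δ ≤ C := (Nat.le_ceil _).trans (by rw [hC]; push_cast; linarith)
    rwa [div_le_iff₀ hδ] at h1
  refine ⟨2 * d + 1 + C + 8 * C * d, fun B hB A T hA hT n hn heven => ?_⟩
  obtain ⟨m, hnm⟩ := heven
  set t := T n with ht
  set s := C * ((t + 2) * d) with hs
  have hρ : 1 ≤ (t + 2) * d := Nat.mul_pos (by omega) hd
  have hs2 : 2 * ((t + 2) * d) < s := Nat.mul_lt_mul_of_pos_right (by omega) hρ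
  obtain ⟨G, _, L, K, hbip, hreg, hmax, hK, hcut⟩ :=
    exists_labelling_cutSize_le A (t := t) hnm hd (by omega) hs2 (hB n)
  obtain ⟨x, hx, hxα⟩ := hA n G hbip hreg L
  have hx' := hcut (hT n G hbip hreg L) x hx
  set N := expTower (2 * ((t + 1) * d) - 1) (s ^ 4) with hN
  have hN1 : 1 ≤ N := (Nat.one_le_pow _ _ (by omega)).trans (le_expTower _ _)
  have hd0 : (0 : ℝ) < d := by exact_mod_cast hd
  -- The cut is large, so a constant fraction of the columns is outside the blocks.
  have hnN : n ≤ C * N := by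
    have h1 : (((d % 2 : ℕ) : ℝ) / d + δ) * (m * d) ≤ ((d % 2 : ℕ) : ℝ) * m +
        d * (N + 1 + 2 * (((t + 2) * d : ℕ) : ℝ) * K) := by
      calc (((d % 2 : ℕ) : ℝ) / d + δ) * (m * d)
          ≤ (((d % 2 : ℕ) : ℝ) / d + δ) * (maxCut G : ℝ) := by
            gcongr
            exact_mod_cast hmax
        _ ≤ cutSize G x := hxα
        _ ≤ _ := by exact_mod_cast hx'
    have h2 : (((d % 2 : ℕ) : ℝ) / d + δ) * (m * d) = ((d % 2 : ℕ) : ℝ) * m + d * (δ * m) := by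
      field_simp
    rw [h2, add_le_add_iff_left, mul_le_mul_iff_right₀ hd0] at h1
    -- The ends of the blocks are at most a fraction `2 / C ≤ δ / 4` of all columns.
    have h3 : (C : ℝ) * ((((t + 2) * d : ℕ) : ℝ) * K) ≤ m := by
      have : C * ((t + 2) * d * K) ≤ m := by rw [← mul_assoc]; exact hK
      exact_mod_cast this
    have h4 : 8 * ((((t + 2) * d : ℕ) : ℝ) * K) ≤ δ * m := by
      have h5 : (0 : ℝ) ≤ (((t + 2) * d : ℕ) : ℝ) * K := by positivity
      nlinarith
    have h6 : (1 : ℝ) ≤ N := by exact_mod_cast hN1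
    have h7 : δ * m ≤ 4 * N := by nlinarith
    have h8 : δ * (n : ℝ) ≤ δ * (C * N) := by
      rw [hnm]; push_cast; nlinarith
    exact_mod_cast le_of_mul_le_mul_left h8 hδ
  have hs1 : 1 ≤ s ^ 4 := Nat.one_le_pow _ _ (by omega)
  have hlog : logStar (n : ℝ) ≤
      2 * ((t + 1) * d) - 1 + logStar ((C * s ^ 4 : ℕ) : ℝ) := by
    refine (logStar_mono ?_).trans (logStar_expTower_le _ _)
    exact_mod_cast hnN.trans (mul_expTower_le _ (by omega) hs1)
  have hCs : logStar ((C * s ^ 4 : ℕ) : ℝ) ≤ 1 + (C + s * 4) := by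
    have h1 : C * s ^ 4 ≤ 2 ^ (C + s * 4) := by
      rw [pow_add, pow_mul]
      exact Nat.mul_le_mul Nat.lt_two_pow_self.le
        (Nat.pow_le_pow_left Nat.lt_two_pow_self.le 4)
    have h2 : ((C * s ^ 4 : ℕ) : ℝ) ≤ ((2 ^ (C + s * 4) : ℕ) : ℝ) := by exact_mod_cast h1
    exact ((logStar_mono h2).trans (logStar_two_pow_le _)).trans
      (Nat.add_le_add_left (logStar_natCast_le _) 1)
  calc logStar (n : ℝ) ≤ 2 * ((t + 1) * d) + (1 + (C + s * 4)) := by omega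
    _ ≤ (2 * d + 1 + C + 8 * C * d) * (t + 1) := by
      rw [hs]
      have : 0 ≤ C * t + t + 4 * C * d * t := Nat.zero_le _
      nlinarith

/-- Passing from a bound `log* n ≤ K (T n + 1)` to `log* n = O(T n)`: for large `n` the bound
excludes `T n = 0`. -/
theorem exists_mul_logStar_le (d : ℕ) (hd : 1 ≤ d) (δ : ℝ) (hδ : 0 < δ) :
    ∃ c : ℝ, 0 < c ∧ ∃ n₀ : ℕ, ∀ B : ℕ → ℕ, (∀ n, n ≤ B n) →
      ∀ (A : LocalAlgorithm.{u}) (T : ℕ → ℕ),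
        A.IsMaxCutApprox d B (((d % 2 : ℕ) : ℝ) / d + δ) → A.RunsIn d B T →
        ∀ n : ℕ, n₀ ≤ n → Even n → c * (logStar n : ℝ) ≤ (T n : ℝ) := by
  obtain ⟨K, hK⟩ := exists_logStar_le.{u} d hd δ hδ
  refine ⟨1 / (2 * K + 1), by positivity, max (4 * d + 1) (expTower (K + 1) 1),
    fun B hB A T hA hT n hn heven => ?_⟩
  have h1 := hK B hB A T hA hT n ((le_max_left _ _).trans hn) heven
  have h2 : K + 1 ≤ logStar (n : ℝ) :=
    (le_logStar_expTower (K + 1)).trans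
      (logStar_mono (by exact_mod_cast (le_max_right _ _).trans hn))
  have h3 : 1 ≤ T n := by
    by_contra h
    have : T n = 0 := by omega
    rw [this] at h1
    omega
  have h4 : logStar (n : ℝ) ≤ (2 * K + 1) * T n := by nlinarith
  rw [div_mul_eq_mul_div, one_mul, div_le_iff₀ (by positivity), mul_comm]
  exact_mod_cast h4

theorem theorem2p2 (d : ℕ) (hd : 2 ≤ d) :
    (Even d → ∀ α : ℝ, 0 < α →
      ∃ c : ℝ, 0 < c ∧ ∃ n₀ : ℕ, ∀ B : ℕ → ℕ, (∀ n, n ≤ B n) →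
        ∀ (A : LocalAlgorithm.{u}) (T : ℕ → ℕ), A.IsMaxCutApprox d B α → A.RunsIn d B T →
          ∀ n : ℕ, n₀ ≤ n → Even n → c * (logStar n : ℝ) ≤ (T n : ℝ)) ∧
    (Odd d → ∀ ε : ℝ, 0 < ε →
      ∃ c : ℝ, 0 < c ∧ ∃ n₀ : ℕ, ∀ B : ℕ → ℕ, (∀ n, n ≤ B n) →
        ∀ (A : LocalAlgorithm.{u}) (T : ℕ → ℕ), A.IsMaxCutApprox d B (1 / (d : ℝ) + ε) →
          A.RunsIn d B T →
          ∀ n : ℕ, n₀ ≤ n → Even n → c * (logStar n : ℝ) ≤ (T n : ℝ)) := by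
  refine ⟨fun he α hα => ?_, fun ho ε hε => ?_⟩
  · have h := exists_mul_logStar_le.{u} d (by omega) α hα
    rwa [Nat.even_iff.mp he, Nat.cast_zero, zero_div, zero_add] at h
  · have h := exists_mul_logStar_le.{u} d (by omega) ε hε
    rwa [Nat.odd_iff.mp ho, Nat.cast_one] at h
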